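/- **Corollary (Oblique Extension Principle).** *Notation.* On $L^2(\mathbb R)$ let $[Tf](x)=f(x-1)$ and $[Df](x)=2^{1/2}f(2x)$, let $\langle\cdot,\cdot\rangle$ be linear in the first argument, and let $\hat f(y)=\int f(x)e^{-2\pi ixy}\,dx$ be the ($L^2$-)Fourier transform. The unit circle $\partial\mathbb D$ carries normalized Lebesgue measure. For $f\in L^2(\mathbb R)$ and a.e. $\omega=e^{2\pi i\theta}$, $\theta\in[0,1)$, put $\hat f_*(\omega)=\big(\overline{\hat f(\theta+k)}\big)_{k\in\mathbb Z}\in\ell^2(\mathbb Z)$ and $\sigma(f)=\{\omega:\|\hat f_*(\omega)\|_{\ell^2}\ne0\}$. Let $\phi,\tilde\phi\in L^2(\mathbb R)$, let $V_0=\overline{\operatorname{span}}\{T^k\phi:k\in\mathbb Z\}$, $\tilde V_0=\overline{\operatorname{span}}\{T^k\tilde\phi:k\in\mathbb Z\}$, and let $V_1=DV_0$, $\tilde V_1=D\tilde V_0$. Assume that $\phi,\tilde\phi$ are refinable, i.e. $D^{-1}\phi\in V_0$ and $D^{-1}\tilde\phi\in\tilde V_0$. For $f\in V_0$ the mask is $$H_*^f(\omega)=\frac{\langle\hat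 f_*(\omega),\hat\phi_*(\omega)\rangle_{\ell^2}}{\|\hat\phi_*(\omega)\|_{\ell^2}^2}\ (\omega\in\sigma(\phi)),\qquad H_*^f(\omega)=0\ (\omega\notin\sigma(\phi)),$$ and $\tilde H_*^f$ is defined in the same way for $f\in\tilde V_0$, with $\tilde\phi$ in place of $\phi$. Let $\Phi=\{\phi^1,\dots,\phi^r\}\subset V_0$, $\Psi=\{\psi^1,\dots,\psi^s\}\subset V_1$, $\tilde\Phi=\{\tilde\phi^1,\dots,\tilde\phi^r\}\subset\tilde V_0$, $\tilde\Psi=\{\tilde\psi^1,\dots,\tilde\psi^s\}\subset\tilde V_1$, and assume $$\|\widehat{\phi^i}_*\|_{\ell^2}\,\|\widehat{\tilde\phi^i}_*\|_{\ell^2}\in L^\infty(\partial\mathbb D)\ (1\le i\le r),\qquad \|\widehat{\psi^l}_*\|_{\ell^2}\,\|\widehat{\tilde\psi^l}_*\|_{\ell^2}\in L^\infty(\partial\mathbb D)\ (1\le l\le s).$$ Put $\Theta(\omega)=\sum_{i=1}^rH_*^{\phi^i}(\omega)\,\overline{\tilde H_*^{\tilde\phi^i}(\omega)}$. For $J\in\mathbb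 Z$, the systems $X_J(\Phi,\Psi)=\{D^JT^k\phi^i\}_{i,k}\cup\{D^jT^k\psi^l\}_{j\ge J,\,l,\,k}$ and $X_J(\tilde\Phi,\tilde\Psi)$ (defined likewise) form a *dual pair of nonhomogeneous wavelet frames* if for every $f\in L^2(\mathbb R)$ $$f=\sum_{i=1}^r\sum_{k\in\mathbb Z}\langle f,D^JT^k\tilde\phi^i\rangle D^JT^k\phi^i+\sum_{j\ge J}\Big(\sum_{l=1}^s\sum_{k\in\mathbb Z}\langle f,D^jT^k\tilde\psi^l\rangle D^jT^k\psi^l\Big)$$ in $L^2(\mathbb R)$. Here, and in condition 3, it is part of the assertion that each series over $k\in\mathbb Z$ that appears converges unconditionally in $L^2(\mathbb R)$; the series over $j\ge J$ is the $L^2$-limit, as $N\to\infty$, of its partial sums over $J\le j<N$. *Claim.* The following assertions are equivalent: 1. For some $J\in\mathbb Z$, $X_J(\Phi,\Psi)$ and $X_J(\tilde\Phi,\tilde\Psi)$ form a dual pair of nonhomogeneous wavelet frames. 2. For all $J\in\mathbb Z$, $X_J(\Phi,\Psi)$ and $X_J(\tilde\Phi,\tilde\Psi)$ form a dual pair of nonhomogeneous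 wavelet frames. 3. For every $f\in L^2(\mathbb R)$ the series $\sum_{k}\langle f,T^k\tilde\psi^l\rangle T^k\psi^l$ $(1\le l\le s)$ converge unconditionally in $L^2(\mathbb R)$, the completeness condition $$\lim_{J\to\infty}\sum_{i=1}^r\sum_{k\in\mathbb Z}\langle f,D^JT^k\tilde\phi^i\rangle D^JT^k\phi^i=f\qquad(f\in L^2(\mathbb R))$$ holds (each of the series over $k$ being unconditionally convergent, for all $J\in\mathbb Z$), and $$\Theta(\omega^2)H_*^{D^{-1}\phi}(\omega)\overline{\tilde H_*^{D^{-1}\tilde\phi}(\omega)}+\sum_{l=1}^sH_*^{D^{-1}\psi^l}(\omega)\overline{\tilde H_*^{D^{-1}\tilde\psi^l}(\omega)}=2\Theta(\omega)\quad\text{for a.e. }\omega\in\sigma(\phi)\cap\sigma(\tilde\phi),$$ $$\Theta(\omega^2)H_*^{D^{-1}\phi}(\omega)\overline{\tilde H_*^{D^{-1}\tilde\phi}(-\omega)}+\sum_{l=1}^sH_*^{D^{-1}\psi^l}(\omega)\overline{\tilde H_*^{D^{-1}\tilde\psi^l}(-\omega)}=0\quad\text{for a.e. }\omega\in\sigma(\phi)\text{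 with }-\omega\in\sigma(\tilde\phi).$$ -/

import Mathlib

open MeasureTheory Filter Topology FourierTransform ComplexConjugate
open scoped ENNReal

noncomputable section

namespace OEP

/-- The Hilbert space `L²(ℝ)` of complex-valued functions. -/
abbrev L2R : Type := Lp (α := ℝ) ℂ 2 (volume : Measure ℝ)

/-- The Hilbert space `ℓ²(ℤ)` of complex sequences. -/
abbrev EllTwo : Type := lp (fun _ : ℤ => ℂ) 2

/-! ### Translation and dilation -/

/-- The isometry `f ↦ f(· - a)` of `L²(ℝ)`. -/
def shift (a : ℝ) : L2R →ₗᵢ[ℂ] L2R :=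
  Lp.compMeasurePreservingₗᵢ ℂ (fun x : ℝ => x - a) (measurePreserving_sub_right volume a)

theorem coeFn_shift (a : ℝ) (f : L2R) :
    (shift a f : ℝ → ℂ) =ᵐ[volume] fun x => f (x - a) :=
  Lp.coeFn_compMeasurePreserving f (measurePreserving_sub_right volume a)

theorem ae_comp_sub {p : ℝ → Prop} (a : ℝ) (h : ∀ᵐ x, p x) : ∀ᵐ x, p (x - a) :=
  (measurePreserving_sub_right volume a).quasiMeasurePreserving.ae h

theorem shift_shift {a b : ℝ} (hab : a + b = 0) (f : L2R) : shift a (shift b f) = f := by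
  apply Lp.ext
  filter_upwards [coeFn_shift a (shift b f), ae_comp_sub a (coeFn_shift b f)] with x h1 h2
  rw [h1, h2, sub_sub, hab, sub_zero]

/-- The translation operator `[T f](x) = f(x - 1)`, a unitary operator on `L²(ℝ)`. -/
def T : L2R ≃ₗᵢ[ℂ] L2R where
  toLinearEquiv := LinearEquiv.ofLinearMap (shift 1).toLinearMap (shift (-1)).toLinearMap
    (LinearMap.ext fun f => shift_shift (by norm_num) f)
    (LinearMap.ext fun f => shift_shift (by norm_num) f)
  norm_map' f := (shift 1).norm_map f

theorem coeFn_T (f : L2R) : (T f : ℝ → ℂ) =ᵐ[volume] fun x => f (x - 1) :=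
  coeFn_shift 1 f

theorem map_mul_volume {a : ℝ} (ha : 0 < a) :
    Measure.map (fun x : ℝ => a * x) volume = ENNReal.ofReal a⁻¹ • (volume : Measure ℝ) := by
  have := Real.map_volume_mul_left ha.ne'
  rwa [abs_of_pos (inv_pos.2 ha)] at this

theorem ae_comp_mul {p : ℝ → Prop} {a : ℝ} (ha : 0 < a) (h : ∀ᵐ x, p x) :
    ∀ᵐ x, p (a * x) := by
  have h1 : ∀ᵐ x ∂(Measure.map (fun x : ℝ => a * x) volume), p x := by
    rw [map_mul_volume ha]
    exact Measure.ae_smul_measure h _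
  exact ae_of_ae_map (by fun_prop) h1

theorem memLp_scale {a : ℝ} (ha : 0 < a) (f : L2R) :
    MemLp (fun x : ℝ => ((Real.sqrt a : ℝ) : ℂ) * f (a * x)) 2 volume := by
  have h1 : MemLp f 2 (Measure.map (fun x : ℝ => a * x) volume) := by
    rw [map_mul_volume ha]
    exact (Lp.memLp f).smul_measure ENNReal.ofReal_ne_top
  exact (h1.comp_of_map (by fun_prop)).const_mul _

theorem eLpNorm_scale {a : ℝ} (ha : 0 < a) (f : L2R) :
    eLpNorm (fun x : ℝ => ((Real.sqrt a : ℝ) : ℂ) * f (a * x)) 2 volume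
      = eLpNorm f 2 volume := by
  have h1 : AEStronglyMeasurable f (Measure.map (fun x : ℝ => a * x) volume) := by
    rw [map_mul_volume ha]
    exact (Lp.aestronglyMeasurable f).smul_measure _
  have h2 : eLpNorm (fun x : ℝ => f (a * x)) 2 volume
      = ENNReal.ofReal (Real.sqrt a)⁻¹ * eLpNorm f 2 volume := by
    have h3 := eLpNorm_map_measure (p := 2) h1
      (by fun_prop : AEMeasurable (fun x : ℝ => a * x) volume)
    rw [map_mul_volume ha, eLpNorm_smul_measure_of_ne_top (by norm_num)] at h3
    have h4 : (f : ℝ → ℂ) ∘ (fun x : ℝ => a * x) = fun x : ℝ => f (a * x) := rfl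
    rw [h4] at h3
    rw [← h3, smul_eq_mul, ENNReal.ofReal_rpow_of_pos (inv_pos.2 ha)]
    congr 2
    rw [Real.sqrt_eq_rpow, Real.inv_rpow ha.le]
    norm_num
  have h5 := eLpNorm_const_smul (((Real.sqrt a : ℝ) : ℂ)) (fun x : ℝ => f (a * x)) 2 volume
  have h6 : ((((Real.sqrt a : ℝ) : ℂ)) • fun x : ℝ => f (a * x))
      = fun x : ℝ => ((Real.sqrt a : ℝ) : ℂ) * f (a * x) := rfl
  have hs : 0 < Real.sqrt a := Real.sqrt_pos.2 ha
  rw [h6] at h5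
  rw [h5, h2, ← mul_assoc]
  have h7 : ‖((Real.sqrt a : ℝ) : ℂ)‖ₑ = ENNReal.ofReal (Real.sqrt a) := by
    rw [← ofReal_norm, Complex.norm_real, Real.norm_of_nonneg hs.le]
  rw [h7, ← ENNReal.ofReal_mul hs.le, mul_inv_cancel₀ hs.ne', ENNReal.ofReal_one, one_mul]

/-- The isometry `f ↦ a^{1/2} f(a ·)` of `L²(ℝ)`, for `a > 0`. -/
def scale (a : ℝ) (ha : 0 < a) : L2R →ₗᵢ[ℂ] L2R where
  toFun f := (memLp_scale ha f).toLp _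
  map_add' f g := by
    apply Lp.ext
    filter_upwards [(memLp_scale ha (f + g)).coeFn_toLp, (memLp_scale ha f).coeFn_toLp,
      (memLp_scale ha g).coeFn_toLp, ae_comp_mul ha (Lp.coeFn_add f g),
      Lp.coeFn_add ((memLp_scale ha f).toLp _) ((memLp_scale ha g).toLp _)]
      with x h1 h2 h3 h4 h5
    rw [h1, h5, Pi.add_apply, h2, h3, h4, Pi.add_apply, mul_add]
  map_smul' c f := by
    apply Lp.ext
    filter_upwards [(memLp_scale ha (c • f)).coeFn_toLp, (memLp_scale ha f).coeFn_toLp,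
      ae_comp_mul ha (Lp.coeFn_smul c f),
      Lp.coeFn_smul c ((memLp_scale ha f).toLp _)] with x h1 h2 h4 h5
    rw [h1, RingHom.id_apply, h5, Pi.smul_apply, h2, h4, Pi.smul_apply, smul_eq_mul,
      smul_eq_mul, mul_left_comm]
  norm_map' f := by
    change ‖(memLp_scale ha f).toLp _‖ = ‖f‖
    rw [Lp.norm_toLp, Lp.norm_def, eLpNorm_scale ha f]

theorem coeFn_scale {a : ℝ} (ha : 0 < a) (f : L2R) :
    (scale a ha f : ℝ → ℂ) =ᵐ[volume] fun x => ((Real.sqrt a : ℝ) : ℂ) * f (a * x) :=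
  (memLp_scale ha f).coeFn_toLp

theorem scale_scale {a b : ℝ} (ha : 0 < a) (hb : 0 < b) (hab : a * b = 1) (f : L2R) :
    scale a ha (scale b hb f) = f := by
  apply Lp.ext
  filter_upwards [coeFn_scale ha (scale b hb f), ae_comp_mul ha (coeFn_scale hb f)]
    with x h1 h2
  rw [h1, h2, ← mul_assoc, ← mul_assoc, ← Complex.ofReal_mul, ← Real.sqrt_mul ha.le, hab,
    mul_comm b a, hab]
  simp

/-- The dyadic dilation operator `[D f](x) = 2^{1/2} f(2x)`, a unitary operator on `L²(ℝ)`. -/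
def D : L2R ≃ₗᵢ[ℂ] L2R where
  toLinearEquiv := LinearEquiv.ofLinearMap (scale 2 (by norm_num)).toLinearMap
    (scale 2⁻¹ (by norm_num)).toLinearMap
    (LinearMap.ext fun f => scale_scale (by norm_num) (by norm_num) (by norm_num) f)
    (LinearMap.ext fun f => scale_scale (by norm_num) (by norm_num) (by norm_num) f)
  norm_map' f := (scale 2 (by norm_num)).norm_map f

theorem coeFn_D (f : L2R) :
    (D f : ℝ → ℂ) =ᵐ[volume] fun x => ((Real.sqrt 2 : ℝ) : ℂ) * f (2 * x) :=
  coeFn_scale two_pos f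

/-- The element `D^j T^k f` of a wavelet system. -/
def wav (j k : ℤ) (f : L2R) : L2R := (D ^ j) ((T ^ k) f)

/-! ### Shift-invariant spaces and refinability -/

/-- `V₀ = closed span {T^k φ : k ∈ ℤ}`. -/
def V0 (φ : L2R) : Submodule ℂ L2R :=
  (Submodule.span ℂ (Set.range fun k : ℤ => (T ^ k) φ)).topologicalClosure

/-- `V_j = D^j V₀`. -/
def V (φ : L2R) (j : ℤ) : Submodule ℂ L2R :=
  (V0 φ).map ((D ^ j : L2R ≃ₗᵢ[ℂ] L2R).toLinearEquiv : L2R →ₗ[ℂ] L2R)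

/-- `φ` is refinable: `D⁻¹ φ ∈ V₀`. -/
def IsRefinable (φ : L2R) : Prop := D⁻¹ φ ∈ V0 φ

/-! ### The unit circle and the periodized Fourier transform -/

instance : MeasurableSpace Circle := borel Circle

instance : BorelSpace Circle := ⟨rfl⟩

/-- Normalized Lebesgue measure `dω/(2π)` on the unit circle: the image of Lebesgue measure on
`[0,1)` under `θ ↦ e^{2πiθ}`. -/
def circleMeasure : Measure Circle :=
  (volume.restrict (Set.Ico (0 : ℝ) 1)).map fun θ : ℝ => Circle.exp (2 * Real.pi * θ)

/-- The number `θ ∈ [0,1)` with `ω = e^{2πiθ}`. -/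
def angle (ω : Circle) : ℝ := Int.fract (Complex.arg (ω : ℂ) / (2 * Real.pi))

/-- The sequence `k ↦ conj (f̂(θ + k))`, where `ω = e^{2πiθ}`, `θ ∈ [0,1)`, and `f̂` is the
`L²`-Fourier transform `f̂(y) = ∫ f(x) e^{-2πixy} dx`. -/
def fiberSeq (f : L2R) (ω : Circle) (k : ℤ) : ℂ :=
  conj ((𝓕 f : L2R) (angle ω + k))

open scoped Classical in
/-- The periodized Fourier transform `f̂_* : ∂𝔻 → ℓ²(ℤ)`. The sequence `fiberSeq f ω` is square
summable for almost every `ω`; on the exceptional null set the value is `0`. -/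
def per (f : L2R) (ω : Circle) : EllTwo :=
  if h : Memℓp (fiberSeq f ω) 2 then ⟨fiberSeq f ω, h⟩ else 0

/-- `σ(f) = supp ‖f̂_*‖`, a subset of the unit circle. -/
def spec (f : L2R) : Set Circle := {ω | ‖per f ω‖ ≠ 0}

open scoped Classical in
/-- The mask `H_*^f` of `f` relative to `V₀ = closed span {T^k φ}`:
`⟨f̂_*(ω), φ̂_*(ω)⟩ / ‖φ̂_*(ω)‖²` on `σ(φ)` and `0` off `σ(φ)`.
The inner product of Mathlib is linear in its second argument. -/
def mask (φ f : L2R) (ω : Circle) : ℂ :=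
  if ω ∈ spec φ then inner ℂ (per φ ω) (per f ω) / ((‖per φ ω‖ : ℂ) ^ 2) else 0

/-! ### Dual pairs of nonhomogeneous wavelet systems -/

/-- The summand `⟨f, D^j T^k φ̃⟩ D^j T^k φ`. -/
def term (φ φt : L2R) (j : ℤ) (f : L2R) (k : ℤ) : L2R :=
  (inner ℂ (wav j k φt) f) • wav j k φ

/-- For all generators and all `f`, the series `∑_k ⟨f, D^j T^k φ̃^i⟩ D^j T^k φ^i` converges
(unconditionally) in `L²(ℝ)`. -/
def LevelConverges {n : ℕ} (Φ Φt : Fin n → L2R) (j : ℤ) : Prop :=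
  ∀ (i : Fin n) (f : L2R), Summable (term (Φ i) (Φt i) j f)

/-- `∑_i ∑_k ⟨f, D^j T^k φ̃^i⟩ D^j T^k φ^i`. -/
def levelSum {n : ℕ} (Φ Φt : Fin n → L2R) (j : ℤ) (f : L2R) : L2R :=
  ∑ i, ∑' k : ℤ, term (Φ i) (Φt i) j f k

/-- `X_J(Φ,Ψ)` and `X_J(Φ̃,Ψ̃)` form a dual pair of nonhomogeneous wavelet frames for `L²(ℝ)`:
every `f` is the sum in `L²(ℝ)` of
`∑_i ∑_k ⟨f, D^J T^k φ̃^i⟩ D^J T^k φ^i + ∑_{j ≥ J} ∑_l ∑_k ⟨f, D^j T^k ψ̃^l⟩ D^j T^k ψ^l`,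
where the series over `k` converge and the series over the scales `j ≥ J` is the limit of its
partial sums over `J ≤ j < N`, as `N → ∞`. -/
def IsDualPair {r s : ℕ} (Φ Φt : Fin r → L2R) (Ψ Ψt : Fin s → L2R) (J : ℤ) : Prop :=
  LevelConverges Φ Φt J ∧ (∀ j : ℤ, J ≤ j → LevelConverges Ψ Ψt j) ∧
    ∀ f : L2R, Tendsto
      (fun N : ℤ => levelSum Φ Φt J f + ∑ j ∈ Finset.Ico J N, levelSum Ψ Ψt j f) atTop (𝓝 f)

/-- The completeness condition:
`lim_{J → ∞} ∑_i ∑_k ⟨f, D^J T^k φ̃^i⟩ D^J T^k φ^i = f` for all `f`, the series over `k` being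
convergent. -/
def Completeness {r : ℕ} (Φ Φt : Fin r → L2R) : Prop :=
  (∀ J : ℤ, LevelConverges Φ Φt J) ∧
    ∀ f : L2R, Tendsto (fun J : ℤ => levelSum Φ Φt J f) atTop (𝓝 f)

/-! ### The mask identities -/

/-- `Θ(ω) = ∑_i H_*^{φ^i}(ω) conj (H̃_*^{φ̃^i}(ω))`. -/
def Theta {r : ℕ} (φ φt : L2R) (Φ Φt : Fin r → L2R) (ω : Circle) : ℂ :=
  ∑ i, mask φ (Φ i) ω * conj (mask φt (Φt i) ω)

/-- The first mask identity. -/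
def MaskIdentityOne {r s : ℕ} (φ φt : L2R) (Φ Φt : Fin r → L2R) (Ψ Ψt : Fin s → L2R) : Prop :=
  ∀ᵐ ω ∂circleMeasure, ω ∈ spec φ ∩ spec φt →
    Theta φ φt Φ Φt (ω ^ 2) * mask φ (D⁻¹ φ) ω * conj (mask φt (D⁻¹ φt) ω)
      + ∑ l, mask φ (D⁻¹ (Ψ l)) ω * conj (mask φt (D⁻¹ (Ψt l)) ω)
      = 2 * Theta φ φt Φ Φt ω

/-- The second mask identity. -/
def MaskIdentityTwo {r s : ℕ} (φ φt : L2R) (Φ Φt : Fin r → L2R) (Ψ Ψt : Fin s → L2R) : Prop :=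
  ∀ᵐ ω ∂circleMeasure, ω ∈ spec φ → -ω ∈ spec φt →
    Theta φ φt Φ Φt (ω ^ 2) * mask φ (D⁻¹ φ) ω * conj (mask φt (D⁻¹ φt) (-ω))
      + ∑ l, mask φ (D⁻¹ (Ψ l)) ω * conj (mask φt (D⁻¹ (Ψt l)) (-ω))
      = 0

end OEP

end

/-! Write $P_J$ and $Q_j$ for the operators `levelSum Φ Φt J` and `levelSum Ψ Ψt j`. Conjugation by
powers of $D$ carries one level to any other, so convergence at one level gives it at all levels,
and a dual pair at one $J$ gives one at every $J$ (`IsDualPair.of_level`). Comparing the expansions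
from two consecutive levels gives $P_{J+1}=P_J+Q_J$; conversely this relation telescopes to
$P_J+\sum_{J\le j<N}Q_j=P_N$. Hence dual pairs at all levels amount to convergence, completeness and
the single identity $P_0=P_{-1}+Q_{-1}$ (`forall_isDualPair_iff`).

That identity is read off on the Fourier side from test functions whose transforms are indicators of
subsets of the cells $(a/2,(a+1)/2]$. Since $D^{-1}T^k=T^{2k}D^{-1}$, level $-1$ coefficients are
Fourier coefficients on an interval of length $1/2$, and Parseval turns matrix entries into
integrals of $\sum_i\hat f_i(y)\overline{\hat g_i(y+d/2)}$. At level $0$ the odd translates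
contribute the same integral times $e^{\pi id}$, whence a factor $1+e^{\pi id}$, which is $2$ or $0$
according to the parity of $d$. So the operator identity is a pointwise identity of kernels
(`levelSum_zero_eq_iff`).

Finally, $\hat f(y)=\overline{H_*^f(e^{2\pi iy})}\,\hat\phi(y)$ for $f\in V_0$
(`ae_fourier_eq_mask_mul`). Substituting this and cancelling
$\hat\phi(y)\overline{\hat{\tilde\phi}(y+d/2)}$ leaves the first mask identity for even $d$ and the
second for odd $d$ (`maskIdentities_iff`). -/

namespace OEP

/-! ### The Fourier transform, translations and dilations -/

/-- The point `e^{2πiy}` of the unit circle. -/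
noncomputable def expc (y : ℝ) : Circle := Circle.exp (2 * Real.pi * y)

theorem continuous_fourier_L2R : Continuous fun f : L2R => (𝓕 f : L2R) :=
  (Lp.fourierTransformₗᵢ ℝ ℂ).continuous

theorem exists_subseq_tendsto_ae {u : ℕ → L2R} {v : L2R} (h : Tendsto u atTop (𝓝 v)) :
    ∃ ns : ℕ → ℕ, StrictMono ns ∧
      ∀ᵐ x : ℝ, Tendsto (fun i => u (ns i) x) atTop (𝓝 (v x)) :=
  (tendstoInMeasure_of_tendsto_Lp h).exists_seq_tendsto_ae

/-- An $L^2$-convergent sequence converges a.e. along a subsequence, so the pointwise relation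
survives limits. The hypothesis on `s` keeps null sets null under composition. -/
theorem isClosed_setOf_ae_eq_mul_comp {A B : L2R → L2R} (hA : Continuous A) (hB : Continuous B)
    (c : ℝ → ℂ) {s : ℝ → ℝ} (hs : ∀ p : ℝ → Prop, (∀ᵐ y, p y) → ∀ᵐ y, p (s y)) :
    IsClosed {f : L2R | ∀ᵐ y : ℝ, A f y = c y * B f (s y)} := by
  refine isClosed_of_closure_subset fun f hf => ?_
  obtain ⟨u, hu, huf⟩ := mem_closure_iff_seq_limit.1 hf
  obtain ⟨n₁, hn₁, h₁⟩ := exists_subseq_tendsto_ae ((hA.tendsto f).comp huf)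
  -- Extracted from the first subsequence, so that both limits hold along a common one.
  obtain ⟨n₂, hn₂, h₂⟩ := exists_subseq_tendsto_ae
    (((hB.tendsto f).comp huf).comp hn₁.tendsto_atTop)
  have hall : ∀ᵐ y : ℝ, ∀ n, A (u n) y = c y * B (u n) (s y) := ae_all_iff.2 hu
  filter_upwards [h₁, hs _ h₂, hall] with y h₁ h₂ hy
  refine tendsto_nhds_unique (h₁.comp hn₂.tendsto_atTop) ?_
  refine (h₂.const_mul (c y)).congr fun i => ?_
  simp [hy]

/-- Both sides are closed conditions on `f`, so the formula need only be checked on the dense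
Schwartz functions, where the transform is an integral. -/
theorem fourier_ae_of_schwartz {A : L2R → L2R} (hA : Continuous A)
    (c : ℝ → ℂ) {s : ℝ → ℝ} (hs : ∀ p : ℝ → Prop, (∀ᵐ y, p y) → ∀ᵐ y, p (s y))
    (h : ∀ f : SchwartzMap ℝ ℂ, ∃ g : SchwartzMap ℝ ℂ, A (f.toLp 2) = g.toLp 2 ∧
      ∀ y, 𝓕 (g : ℝ → ℂ) y = c y * 𝓕 (f : ℝ → ℂ) (s y)) (f : L2R) :
    ∀ᵐ y : ℝ, (𝓕 (A f) : L2R) y = c y * (𝓕 f : L2R) (s y) := by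
  have hcl := isClosed_setOf_ae_eq_mul_comp (continuous_fourier_L2R.comp hA)
    continuous_fourier_L2R c hs
  refine (SchwartzMap.denseRange_toLpCLM (E := ℝ) (F := ℂ) (p := 2) ENNReal.ofNat_ne_top
    (μ := volume)).induction_on (p := fun f : L2R => ∀ᵐ y : ℝ, (𝓕 (A f) : L2R) y =
      c y * (𝓕 f : L2R) (s y)) f hcl fun f => ?_
  obtain ⟨g, hg, hfg⟩ := h f
  rw [SchwartzMap.toLpCLM_apply, hg, SchwartzMap.toLp_fourier_eq, SchwartzMap.toLp_fourier_eq]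
  filter_upwards [(𝓕 g).coeFn_toLp 2 volume, hs _ ((𝓕 f).coeFn_toLp 2 volume)] with y h1 h2
  rw [h1, h2, SchwartzMap.fourier_coe, SchwartzMap.fourier_coe, hfg]

theorem fourier_shift (a : ℝ) (f : L2R) :
    ∀ᵐ y : ℝ, (𝓕 (shift a f) : L2R) y = expc (-(a * y)) * (𝓕 f : L2R) y := by
  refine fourier_ae_of_schwartz (s := fun y => y) (shift a).continuous _ (fun _ h => h)
    (fun f => ⟨f.compSubConstCLM ℂ a, ?_, fun y => ?_⟩) f
  · apply Lp.ext
    filter_upwards [coeFn_shift a (f.toLp 2), ae_comp_sub a (f.coeFn_toLp 2 volume),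
      (f.compSubConstCLM ℂ a).coeFn_toLp 2 volume] with x h1 h2 h3
    rw [h1, h2, h3, SchwartzMap.compSubConstCLM_apply]
  · rw [Real.fourier_eq', Real.fourier_eq', ← integral_const_mul,
      ← integral_add_right_eq_self _ a]
    refine integral_congr_ae (ae_of_all _ fun x => ?_)
    simp only [SchwartzMap.compSubConstCLM_apply, add_sub_cancel_right, smul_eq_mul,
      ← mul_assoc, expc, Circle.coe_exp, ← Complex.exp_add]
    congr 2
    simp
    ring

theorem shift_add (a b : ℝ) (f : L2R) : shift a (shift b f) = shift (a + b) f := by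
  apply Lp.ext
  filter_upwards [coeFn_shift a (shift b f), ae_comp_sub a (coeFn_shift b f),
    coeFn_shift (a + b) f] with x h1 h2 h3
  rw [h1, h2, h3, sub_sub]

theorem T_zpow_eq_shift (k : ℤ) (f : L2R) : (T ^ k) f = shift k f := by
  induction k using Int.induction_on generalizing f with
  | zero =>
    apply Lp.ext
    filter_upwards [coeFn_shift ((0 : ℤ) : ℝ) f] with x h
    rw [h]
    simp
  | succ n ih =>
    rw [zpow_add_one]
    change (T ^ (n : ℤ)) (shift 1 f) = _
    rw [ih, shift_add]
    push_cast
    rfl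
  | pred n ih =>
    rw [zpow_sub_one]
    change (T ^ (-n : ℤ)) (shift (-1) f) = _
    rw [ih, shift_add]
    push_cast
    rfl

theorem fourier_T_zpow (k : ℤ) (f : L2R) :
    ∀ᵐ y : ℝ, (𝓕 ((T ^ k) f) : L2R) y = expc (-(k * y)) * (𝓕 f : L2R) y := by
  rw [T_zpow_eq_shift]
  exact fourier_shift k f

theorem fourier_D_inv (f : L2R) :
    ∀ᵐ y : ℝ, (𝓕 (D⁻¹ f) : L2R) y = (Real.sqrt 2 : ℂ) * (𝓕 f : L2R) (2 * y) := by
  refine fourier_ae_of_schwartz (A := scale 2⁻¹ (by norm_num)) (s := fun y => 2 * y)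
    (LinearIsometry.continuous _) _
    (fun _ h => ae_comp_mul two_pos h) (fun f => ?_) f
  have h2 : (2⁻¹ : ℝ) ≠ 0 := by norm_num
  let L : ℝ ≃L[ℝ] ℝ := ContinuousLinearEquiv.smulLeft (Units.mk0 (2⁻¹ : ℝ) h2)
  refine ⟨((Real.sqrt 2⁻¹ : ℝ) : ℂ) • SchwartzMap.compCLMOfContinuousLinearEquiv ℂ L f,
    ?_, fun y => ?_⟩
  · apply Lp.ext
    have ha : (0 : ℝ) < 2⁻¹ := by norm_num
    filter_upwards [coeFn_scale ha (f.toLp 2), ae_comp_mul ha (f.coeFn_toLp 2 volume),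
      SchwartzMap.coeFn_toLp (((Real.sqrt 2⁻¹ : ℝ) : ℂ) •
        SchwartzMap.compCLMOfContinuousLinearEquiv ℂ L f) 2 volume] with x h1 h2 h3
    rw [h1, h2, h3]
    rfl
  · rw [Real.fourier_eq', Real.fourier_eq', ← integral_const_mul]
    -- The substitution has Jacobian $2$, and $2\sqrt{1/2}=\sqrt2$.
    have := Measure.integral_comp_mul_left (fun x : ℝ => (Real.sqrt 2 : ℂ) *
      (Complex.exp (↑(-2 * Real.pi * inner ℝ x (2 * y)) * Complex.I) • f x)) 2⁻¹
    rw [inv_inv, abs_two] at this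
    rw [← inv_smul_eq_iff₀ two_ne_zero, ← integral_smul] at this
    rw [← this]
    refine integral_congr_ae (ae_of_all _ fun x => ?_)
    have hs : ((Real.sqrt 2⁻¹ : ℝ) : ℂ) = 2⁻¹ * (Real.sqrt 2 : ℝ) := by
      rw [← Complex.ofReal_ofNat, ← Complex.ofReal_inv, ← Complex.ofReal_mul]
      congr 1
      rw [Real.sqrt_inv]
      field_simp
      simp
    have hL : L x = 2⁻¹ * x := rfl
    have hi : inner ℝ (2⁻¹ * x) (2 * y) = inner ℝ x y := by
      simp; ring
    simp only [smul_apply, SchwartzMap.compCLMOfContinuousLinearEquiv_apply,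
      Function.comp_apply, hL, hs, smul_eq_mul, hi, Complex.real_smul]
    push_cast
    ring

/-! ### Fibers of the Fourier transform over the unit circle -/

theorem ae_comp_add {p : ℝ → Prop} (a : ℝ) (h : ∀ᵐ x, p x) : ∀ᵐ x, p (x + a) :=
  (measurePreserving_add_right volume a).quasiMeasurePreserving.ae h

theorem expc_add_intCast (y : ℝ) (k : ℤ) : expc (y + k) = expc y := by
  rw [expc, expc, Circle.exp_eq_exp]
  exact ⟨k, by ring⟩

theorem angle_expc (y : ℝ) : angle (expc y) = Int.fract y := by
  obtain ⟨m, hm⟩ := Circle.exp_eq_exp.1 (Circle.exp_arg (expc y))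
  rw [angle, hm, Int.fract_eq_fract]
  refine ⟨m, ?_⟩
  field_simp
  ring

theorem expc_angle (ω : Circle) : expc (angle ω) = ω := by
  rw [angle, ← Int.self_sub_floor, sub_eq_add_neg, ← Int.cast_neg, expc_add_intCast, expc,
    mul_div_cancel₀ _ (by positivity), Circle.exp_arg]

theorem measurable_angle : Measurable angle := by
  have hc : Continuous fun ω : Circle => (ω : ℂ) := by fun_prop
  have : Measurable fun ω : Circle => (ω : ℂ) := hc.measurable
  exact measurable_fract.comp ((Complex.measurable_arg.comp this).div_const _)

theorem continuous_expc : Continuous expc := by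
  unfold expc; fun_prop

theorem ae_circleMeasure_iff {p : Circle → Prop} :
    (∀ᵐ ω ∂circleMeasure, p ω) ↔ ∀ᵐ y : ℝ, p (expc y) := by
  have hmeas : Measurable expc := continuous_expc.measurable
  constructor
  · intro h
    have h1 : ∀ᵐ θ ∂(volume.restrict (Set.Ico (0 : ℝ) 1)), p (expc θ) :=
      ae_of_ae_map hmeas.aemeasurable h
    rw [ae_restrict_iff' measurableSet_Ico] at h1
    filter_upwards [ae_all_iff.2 fun n : ℤ => ae_comp_add (n : ℝ) h1] with y hy
    have := hy (-⌊y⌋)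
    rw [expc_add_intCast, Int.cast_neg, ← sub_eq_add_neg, Int.self_sub_floor] at this
    exact this ⟨Int.fract_nonneg y, Int.fract_lt_one y⟩
  · intro h
    -- `p` need not be measurable: a measurable null hull of the exceptional set is pulled back
    -- along `angle`, a section of `expc`.
    have hN : volume (toMeasurable volume {y : ℝ | ¬ p (expc y)}) = 0 := by
      rw [measure_toMeasurable]; exact h
    refine measure_mono_null (t := angle ⁻¹' toMeasurable volume {y : ℝ | ¬ p (expc y)})
      (fun ω hω => subset_toMeasurable _ _ (?_ : ¬ p (expc (angle ω)))) ?_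
    · rwa [expc_angle]
    · have hm := measurableSet_toMeasurable volume {y : ℝ | ¬ p (expc y)}
      change Measure.map expc _ _ = 0
      rw [Measure.map_apply hmeas (measurable_angle hm),
        Measure.restrict_apply (hmeas (measurable_angle hm))]
      refine measure_mono_null ?_ hN
      rintro θ ⟨hθ, hθ1⟩
      simpa [angle_expc, Int.fract_eq_self.2 ⟨hθ1.1, hθ1.2⟩] using hθ

theorem fiberSeq_expc (f : L2R) (y : ℝ) (k : ℤ) :
    fiberSeq f (expc y) k = conj ((𝓕 f : L2R) (y + ((k - ⌊y⌋ : ℤ) : ℝ))) := by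
  rw [fiberSeq, angle_expc, ← Int.self_sub_floor]
  push_cast
  ring_nf

/-- The integral of $|f|^2$ over the line equals the integral over $[0,1)$ of its periodization,
which is therefore finite a.e.; integer translations extend this to almost every `y`. -/
theorem ae_summable_fiber (f : L2R) :
    ∀ᵐ y : ℝ, Summable fun k : ℤ => ‖f (y + k)‖ ^ 2 := by
  have hf : ∫⁻ x, ‖f x‖ₑ ^ 2 ≠ ⊤ := by
    have := (Lp.memLp f).eLpNorm_ne_top
    rw [eLpNorm_eq_lintegral_rpow_enorm_toReal two_ne_zero ENNReal.ofNat_ne_top] at this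
    intro h
    simp [h] at this
  have hmeas : AEMeasurable (fun x => ‖f x‖ₑ ^ 2) volume :=
    (Lp.aestronglyMeasurable f).enorm.pow_const 2
  have key : ∀ᵐ y ∂(volume.restrict (Set.Ico (0 : ℝ) 1)),
      ∑' k : ℤ, ‖f (y + k)‖ₑ ^ 2 < ⊤ := by
    have hsh : ∀ k : ℤ, AEMeasurable (fun y : ℝ => ‖f (y + k)‖ₑ ^ 2) volume := fun k =>
      hmeas.comp_quasiMeasurePreserving
        (measurePreserving_add_right volume (k : ℝ)).quasiMeasurePreserving
    refine ae_lt_top' (AEMeasurable.tsum fun k => (hsh k).restrict) ?_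
    rw [lintegral_tsum fun k => (hsh k).restrict]
    have h1 : ∀ k : ℤ, ∫⁻ y in Set.Ico (0 : ℝ) 1, ‖f (y + k)‖ₑ ^ 2 =
        ∫⁻ y in Set.Ico (k : ℝ) (k + 1), ‖f y‖ₑ ^ 2 := by
      intro k
      have := (measurePreserving_add_right volume (k : ℝ)).setLIntegral_comp_preimage_emb
        (MeasurableEquiv.addRight (k : ℝ)).measurableEmbedding (fun y => ‖f y‖ₑ ^ 2)
        (Set.Ico (k : ℝ) (k + 1))
      rw [← this]
      congr 2
      ext y
      simp
    simp_rw [h1]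
    rw [← lintegral_iUnion (fun _ => measurableSet_Ico)]
    · rw [show (⋃ k : ℤ, Set.Ico (k : ℝ) (k + 1)) = Set.univ from iUnion_Ico_intCast ℝ]
      simpa using hf
    · exact_mod_cast Set.pairwise_disjoint_Ico_intCast ℝ
  rw [ae_restrict_iff' measurableSet_Ico] at key
  filter_upwards [ae_all_iff.2 fun n : ℤ => ae_comp_add (n : ℝ) key] with y hy
  have := hy (-⌊y⌋) (by
    rw [Int.cast_neg, ← sub_eq_add_neg, Int.self_sub_floor]
    exact ⟨Int.fract_nonneg y, Int.fract_lt_one y⟩)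
  have h2 : Summable fun k : ℤ => ‖f (y + (-⌊y⌋ : ℤ) + k)‖ ^ 2 := by
    have := ENNReal.summable_toReal this.ne
    simpa using this
  rw [← (Equiv.addLeft (-⌊y⌋)).summable_iff]
  refine h2.congr fun k => ?_
  simp [add_assoc]

theorem ae_coe_per_expc (f : L2R) :
    ∀ᵐ y : ℝ, ∀ k : ℤ,
      per f (expc y) k = conj ((𝓕 f : L2R) (y + ((k - ⌊y⌋ : ℤ) : ℝ))) := by
  filter_upwards [ae_summable_fiber (𝓕 f : L2R)] with y hy k
  have h : Memℓp (fiberSeq f (expc y)) 2 := by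
    apply memℓp_gen
    simp only [fiberSeq_expc, ENNReal.toReal_ofNat, RCLike.norm_conj, Real.rpow_ofNat]
    exact (Equiv.subRight ⌊y⌋).summable_iff.2 hy
  rw [per, dif_pos h]
  exact fiberSeq_expc f y k

theorem ae_expc_mem_spec_iff (f : L2R) :
    ∀ᵐ y : ℝ, expc y ∈ spec f ↔ ∃ k : ℤ, (𝓕 f : L2R) (y + k) ≠ 0 := by
  filter_upwards [ae_coe_per_expc f] with y hy
  rw [spec, Set.mem_ofPred_eq, norm_ne_zero_iff, ne_eq, ← not_iff_not, not_not]
  push Not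
  constructor
  · intro h k
    have := hy (k + ⌊y⌋)
    rw [h] at this
    simpa using this.symm
  · intro h
    ext k
    rw [hy, h]
    simp

/-- Translation by $n$ multiplies the fiber over $y$ by the scalar $e^{-2\pi iny}$, which does not
depend on `k`; so finite combinations stay on the line through the fiber of `φ`. A
finite-dimensional subspace is closed for pointwise convergence, so a.e. convergent subsequences
keep limits there. -/
theorem ae_fiber_mem_span {φ f : L2R} (hf : f ∈ V0 φ) :
    ∀ᵐ y : ℝ, (fun k : ℤ => (𝓕 f : L2R) (y + k)) ∈
      Submodule.span ℂ {fun k : ℤ => (𝓕 φ : L2R) (y + k)} := by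
  have hint : ∀ {p : ℝ → Prop}, (∀ᵐ y, p y) → ∀ᵐ y : ℝ, ∀ k : ℤ, p (y + k) := fun h =>
    ae_all_iff.2 fun k => ae_comp_add _ h
  have hspan : ∀ g ∈ Submodule.span ℂ (Set.range fun k : ℤ => (T ^ k) φ),
      ∀ᵐ y : ℝ, (fun k : ℤ => (𝓕 g : L2R) (y + k)) ∈
        Submodule.span ℂ {fun k : ℤ => (𝓕 φ : L2R) (y + k)} := by
    intro g hg
    induction hg using Submodule.span_induction with
    | mem g hg =>
      obtain ⟨n, rfl⟩ := hg
      filter_upwards [hint (fourier_T_zpow n φ)] with y hy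
      refine Submodule.mem_span_singleton.2 ⟨(expc (-(n * y)) : ℂ), ?_⟩
      ext k
      rw [hy k, Pi.smul_apply, smul_eq_mul,
        show -((n : ℝ) * (y + k)) = -(n * y) + ((-(n * k) : ℤ) : ℝ) by push_cast; ring,
        expc_add_intCast]
    | zero =>
      have h0 : (𝓕 (0 : L2R) : L2R) = 0 := (Lp.fourierTransformₗᵢ ℝ ℂ).map_zero
      filter_upwards [hint (Lp.coeFn_zero ℂ 2 (volume : Measure ℝ))] with y hy
      rw [h0]
      simp only [hy]
      exact zero_mem _
    | add u v _ _ hu hv =>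
      have h0 : (𝓕 (u + v) : L2R) = 𝓕 u + 𝓕 v := (Lp.fourierTransformₗᵢ ℝ ℂ).map_add u v
      filter_upwards [hu, hv, hint (Lp.coeFn_add (𝓕 u : L2R) (𝓕 v : L2R))] with y h1 h2 hy
      rw [h0]
      simp only [hy]
      exact add_mem h1 h2
    | smul c u _ hu =>
      have h0 : (𝓕 (c • u) : L2R) = c • 𝓕 u := (Lp.fourierTransformₗᵢ ℝ ℂ).map_smul c u
      filter_upwards [hu, hint (Lp.coeFn_smul c (𝓕 u : L2R))] with y h1 hy
      rw [h0]
      simp only [hy]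
      exact Submodule.smul_mem _ c h1
  obtain ⟨u, hu, huf⟩ := mem_closure_iff_seq_limit.1 hf
  obtain ⟨n, -, hn⟩ := exists_subseq_tendsto_ae ((continuous_fourier_L2R.tendsto f).comp huf)
  filter_upwards [hint hn, ae_all_iff.2 fun i => hspan _ (hu i)] with y h1 h2
  refine (Submodule.closed_of_finiteDimensional
    (Submodule.span ℂ {fun k : ℤ => (𝓕 φ : L2R) (y + k)})).mem_of_tendsto
    (tendsto_pi_nhds.2 h1) (Eventually.of_forall fun i => h2 (n i))

/-- The fiber of `f` is a multiple $c$ of that of `φ`, and the quotient defining the mask recovers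
$\bar c$, because `per` conjugates. Off $\sigma(\phi)$ both sides vanish. -/
theorem ae_fourier_eq_mask_mul {φ f : L2R} (hf : f ∈ V0 φ) :
    ∀ᵐ y : ℝ, (𝓕 f : L2R) y = conj (mask φ f (expc y)) * (𝓕 φ : L2R) y := by
  filter_upwards [ae_fiber_mem_span hf, ae_coe_per_expc f, ae_coe_per_expc φ,
    ae_expc_mem_spec_iff φ] with y hspan hpf hpφ hσ
  obtain ⟨c, hc⟩ := Submodule.mem_span_singleton.1 hspan
  have hck : ∀ k : ℤ, (𝓕 f : L2R) (y + k) = c * (𝓕 φ : L2R) (y + k) := fun k =>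
    (congrFun hc k).symm
  have h0 : (𝓕 f : L2R) y = c * (𝓕 φ : L2R) y := by simpa using hck 0
  have hper : per f (expc y) = conj c • per φ (expc y) := by
    ext k
    rw [hpf, hck, map_mul, lp.coeFn_smul, Pi.smul_apply, hpφ, smul_eq_mul]
  by_cases h : expc y ∈ spec φ
  · have hn : ((‖per φ (expc y)‖ : ℂ) ^ 2) ≠ 0 := pow_ne_zero _ (by exact_mod_cast h)
    rw [mask, if_pos h, hper, inner_smul_right, inner_self_eq_norm_sq_to_K, h0]
    rw [RCLike.ofReal_eq_complex_ofReal, mul_div_cancel_right₀ _ hn, Complex.conj_conj]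
  · have : (𝓕 φ : L2R) y = 0 := by
      by_contra h'
      exact h (hσ.2 ⟨0, by simpa using h'⟩)
    rw [h0, this, mul_zero, mul_zero]

/-! ### Test functions and Parseval's identity -/

/-- The fundamental half-interval `(0, 1/2]`. -/
abbrev halfIoc : Set ℝ := Set.Ioc 0 2⁻¹

theorem hasSum_fourierCoeff_mul_conj {T : ℝ} [Fact (0 < T)] {u v : AddCircle T → ℂ}
    (hu : MemLp u 2 AddCircle.haarAddCircle) (hv : MemLp v 2 AddCircle.haarAddCircle) :
    HasSum (fun k : ℤ => fourierCoeff u k * conj (fourierCoeff v k))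
      (∫ t, u t * conj (v t) ∂AddCircle.haarAddCircle) := by
  have h := (fourierBasis (T := T)).hasSum_inner_mul_inner (hv.toLp v) (hu.toLp u)
  have hin : inner ℂ (hv.toLp v) (hu.toLp u) = ∫ t, u t * conj (v t) ∂AddCircle.haarAddCircle := by
    rw [L2.inner_def]
    refine integral_congr_ae ?_
    filter_upwards [hu.coeFn_toLp, hv.coeFn_toLp] with t h1 h2
    rw [h1, h2]
    rfl
  rw [hin] at h
  refine h.congr_fun fun k => ?_
  rw [← inner_conj_symm, ← HilbertBasis.repr_apply_apply, ← HilbertBasis.repr_apply_apply,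
    fourierBasis_repr, fourierBasis_repr, fourierCoeff_congr_ae hu.coeFn_toLp,
    fourierCoeff_congr_ae hv.coeFn_toLp, mul_comm]

theorem hasSum_fourierCoeff_liftIoc {T : ℝ} [hT : Fact (0 < T)] {u v : ℝ → ℂ}
    (hu : MemLp u 2 (volume.restrict (Set.Ioc 0 T)))
    (hv : MemLp v 2 (volume.restrict (Set.Ioc 0 T))) :
    HasSum (fun k : ℤ => (∫ θ in Set.Ioc 0 T, fourier (-k) (θ : AddCircle T) * u θ) *
        conj (∫ θ in Set.Ioc 0 T, fourier (-k) (θ : AddCircle T) * v θ))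
      (T * ∫ θ in Set.Ioc 0 T, u θ * conj (v θ)) := by
  have hlift : ∀ {w : ℝ → ℂ}, MemLp w 2 (volume.restrict (Set.Ioc 0 T)) →
      MemLp (AddCircle.liftIoc T 0 w) 2 AddCircle.haarAddCircle := fun {w} hw => by
    rw [← zero_add T] at hw
    exact hw.memLp_liftIoc.haarAddCircle
  have hT0 : (T : ℂ) ≠ 0 := by exact_mod_cast hT.out.ne'
  have hcoef : ∀ (w : ℝ → ℂ) (k : ℤ), ∫ θ in Set.Ioc 0 T, fourier (-k) (θ : AddCircle T) * w θ =
      T * fourierCoeff (AddCircle.liftIoc T 0 w) k := by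
    intro w k
    rw [fourierCoeff_eq_intervalIntegral _ _ 0, zero_add,
      intervalIntegral.integral_of_le hT.out.le, Complex.real_smul, ← mul_assoc,
      Complex.ofReal_div, Complex.ofReal_one, mul_one_div_cancel hT0, one_mul]
    refine setIntegral_congr_fun measurableSet_Ioc fun θ hθ => ?_
    rw [AddCircle.liftIoc_zero_coe_apply hθ, smul_eq_mul]
  -- Each unnormalized integral is $T$ times a Fourier coefficient, while the Haar integral carries
  -- $1/T$; the net factor is $T$.
  convert! (hasSum_fourierCoeff_mul_conj (hlift hu) (hlift hv)).mul_left ((T : ℂ) ^ 2) using 1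
  · ext k
    rw [hcoef, hcoef, map_mul, Complex.conj_ofReal]
    ring
  · have h1 : ∫ t, AddCircle.liftIoc T 0 u t * conj (AddCircle.liftIoc T 0 v t)
          ∂AddCircle.haarAddCircle =
        ∫ t, AddCircle.liftIoc T 0 (fun θ => u θ * conj (v θ)) t ∂AddCircle.haarAddCircle := rfl
    rw [h1, AddCircle.integral_haarAddCircle, AddCircle.integral_liftIoc_eq_intervalIntegral,
      zero_add, intervalIntegral.integral_of_le hT.out.le, Complex.real_smul]
    push_cast
    field_simp

theorem hasSum_integral_mul_conj_integral {u v : ℝ → ℂ}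
    (hu : MemLp u 2 (volume.restrict halfIoc)) (hv : MemLp v 2 (volume.restrict halfIoc)) :
    HasSum (fun k : ℤ => (∫ θ in halfIoc, expc (-(2 * k * θ)) * u θ) *
        conj (∫ θ in halfIoc, expc (-(2 * k * θ)) * v θ))
      (2⁻¹ * ∫ θ in halfIoc, u θ * conj (v θ)) := by
  have : Fact ((0 : ℝ) < 2⁻¹) := ⟨by norm_num⟩
  have hchar : ∀ (k : ℤ) (θ : ℝ),
      (fourier (-k) (θ : AddCircle (2⁻¹ : ℝ)) : ℂ) = expc (-(2 * k * θ)) := by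
    intro k θ
    rw [fourier_coe_apply, expc, Circle.coe_exp]
    congr 1
    push_cast
    field_simp
  have h := hasSum_fourierCoeff_liftIoc hu hv
  simp_rw [hchar] at h
  simpa using h

theorem measurableSet_halfTest {S : Set ℝ} (hS : MeasurableSet S) (a : ℤ) :
    MeasurableSet ((fun y : ℝ => y - a / 2) ⁻¹' (S ∩ halfIoc)) :=
  (measurable_id.sub_const _) (hS.inter measurableSet_Ioc)

theorem volume_halfTest_ne_top {S : Set ℝ} (hS : MeasurableSet S) (a : ℤ) :
    volume ((fun y : ℝ => y - a / 2) ⁻¹' (S ∩ halfIoc)) ≠ ⊤ := by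
  rw [(measurePreserving_sub_right volume ((a : ℝ) / 2)).measure_preimage
    (hS.inter measurableSet_Ioc).nullMeasurableSet]
  exact ((measure_mono Set.inter_subset_right).trans_lt measure_Ioc_lt_top).ne

/-- The function whose Fourier transform is the indicator of `(S ∩ (0,1/2]) + a/2`. -/
noncomputable def halfTest (a : ℤ) {S : Set ℝ} (hS : MeasurableSet S) : L2R :=
  𝓕⁻ (indicatorConstLp 2 (measurableSet_halfTest hS a) (volume_halfTest_ne_top hS a) (1 : ℂ))

theorem inner_halfTest (a : ℤ) {S : Set ℝ} (hS : MeasurableSet S) (h : L2R) :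
    inner ℂ (halfTest a hS) h = ∫ θ in S ∩ halfIoc, (𝓕 h : L2R) (θ + a / 2) := by
  rw [← Lp.inner_fourier_eq, halfTest, FourierTransform.fourier_fourierInv_eq,
    L2.inner_indicatorConstLp_one,
    ← (measurePreserving_sub_right volume ((a : ℝ) / 2)).setIntegral_preimage_emb
      (MeasurableEquiv.subRight ((a : ℝ) / 2)).measurableEmbedding
      (fun θ => (𝓕 h : L2R) (θ + a / 2))]
  simp only [sub_add_cancel]

theorem memLp_comp_add (f : L2R) (a : ℝ) : MemLp (fun θ => f (θ + a)) 2 volume :=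
  (Lp.memLp f).comp_measurePreserving (measurePreserving_add_right volume a)

theorem inner_halfTest_T_zpow (a : ℤ) {S : Set ℝ} (hS : MeasurableSet S) (h : L2R) (k : ℤ) :
    inner ℂ (halfTest a hS) ((T ^ (2 * k)) h) = ∫ θ in halfIoc, expc (-(2 * k * θ)) *
      S.indicator (fun θ => (𝓕 h : L2R) (θ + a / 2)) θ := by
  rw [inner_halfTest]
  have h1 : ∀ θ, (expc (-(2 * k * θ)) : ℂ) * S.indicator (fun θ => (𝓕 h : L2R) (θ + a / 2)) θ =
      S.indicator (fun θ => (expc (-(2 * k * θ)) : ℂ) * (𝓕 h : L2R) (θ + a / 2)) θ := by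
    intro θ
    by_cases hθ : θ ∈ S <;> simp [hθ]
  simp_rw [h1]
  rw [setIntegral_indicator hS, Set.inter_comm]
  refine integral_congr_ae (ae_restrict_of_ae ?_)
  filter_upwards [ae_comp_add (a / 2 : ℝ) (fourier_T_zpow (2 * k) h)] with θ hθ
  -- For even translates the offset $a/2$ changes the phase by an integer, so the character does not
  -- see the cell.
  rw [hθ, show -(((2 * k : ℤ) : ℝ) * (θ + a / 2)) = -(2 * k * θ) + ((-(k * a) : ℤ) : ℝ) by
    push_cast; ring, expc_add_intCast]

theorem hasSum_halfTest (a b : ℤ) {S S' : Set ℝ} (hS : MeasurableSet S) (hS' : MeasurableSet S')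
    (η ηt : L2R) :
    HasSum (fun k : ℤ => inner ℂ ((T ^ (2 * k)) ηt) (halfTest a hS) *
        inner ℂ (halfTest b hS') ((T ^ (2 * k)) η))
      (2⁻¹ * ∫ θ in S ∩ S' ∩ halfIoc,
        (𝓕 η : L2R) (θ + b / 2) * conj ((𝓕 ηt : L2R) (θ + a / 2))) := by
  have hu : MemLp (S'.indicator fun θ => (𝓕 η : L2R) (θ + b / 2)) 2 (volume.restrict halfIoc) :=
    ((memLp_comp_add _ _).indicator hS').restrict _
  have hv : MemLp (S.indicator fun θ => (𝓕 ηt : L2R) (θ + a / 2)) 2 (volume.restrict halfIoc) :=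
    ((memLp_comp_add _ _).indicator hS).restrict _
  convert hasSum_integral_mul_conj_integral hu hv using 1
  · ext k
    rw [← inner_conj_symm, inner_halfTest_T_zpow, inner_halfTest_T_zpow, mul_comm]
  · congr 1
    have h1 : ∀ θ, S'.indicator (fun θ => (𝓕 η : L2R) (θ + b / 2)) θ *
        conj (S.indicator (fun θ => (𝓕 ηt : L2R) (θ + a / 2)) θ) =
        (S ∩ S').indicator (fun θ => (𝓕 η : L2R) (θ + b / 2) *
          conj ((𝓕 ηt : L2R) (θ + a / 2))) θ := by
      intro θ
      by_cases h1 : θ ∈ S <;> by_cases h2 : θ ∈ S' <;> simp [h1, h2]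
    simp_rw [h1]
    rw [setIntegral_indicator (hS.inter hS'), Set.inter_comm]

theorem ae_of_ae_halfIoc {p : ℝ → Prop}
    (h : ∀ a : ℤ, ∀ᵐ θ ∂volume.restrict halfIoc, p (θ + a / 2)) : ∀ᵐ y, p y := by
  have h2 : ∀ᵐ y : ℝ, ∀ a : ℤ, y - a / 2 ∈ halfIoc → p (y - a / 2 + a / 2) :=
    ae_all_iff.2 fun a => ae_comp_sub (a / 2 : ℝ) ((ae_restrict_iff' measurableSet_Ioc).1 (h a))
  filter_upwards [h2] with y hy
  obtain ⟨a, ha⟩ := Set.mem_iUnion.1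
    ((iUnion_Ioc_zsmul (show (0 : ℝ) < 2⁻¹ by norm_num)).ge (Set.mem_univ y))
  rw [zsmul_eq_mul, zsmul_eq_mul, Set.mem_Ioc] at ha
  push_cast at ha
  simpa using hy a ⟨by linarith, by linarith⟩

theorem eq_zero_of_inner_halfTest {h : L2R}
    (H : ∀ (a : ℤ) (S : Set ℝ) (hS : MeasurableSet S), inner ℂ (halfTest a hS) h = 0) :
    h = 0 := by
  have h1 : ∀ᵐ y : ℝ, (𝓕 h : L2R) y = 0 := by
    refine ae_of_ae_halfIoc fun a => ?_
    have hi : Integrable (fun θ => (𝓕 h : L2R) (θ + a / 2)) (volume.restrict halfIoc) :=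
      ((memLp_comp_add _ _).restrict _).integrable one_le_two
    refine hi.ae_eq_zero_of_forall_setIntegral_eq_zero fun S hS _ => ?_
    rw [Measure.restrict_restrict hS, ← inner_halfTest a hS h, H]
  have h2 : (𝓕 h : L2R) = 0 := by
    apply Lp.ext
    filter_upwards [h1, Lp.coeFn_zero ℂ 2 (volume : Measure ℝ)] with y h1 h2
    rw [h1, h2, Pi.zero_apply]
  exact (Lp.fourierTransformₗᵢ ℝ ℂ).map_eq_zero_iff.1 h2

/-- The test functions are total: nothing nonzero is orthogonal to the kernel of `A - B`, and this
kernel is closed. -/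
theorem eq_of_eq_halfTest {A B : L2R →L[ℂ] L2R}
    (H : ∀ (a : ℤ) (S : Set ℝ) (hS : MeasurableSet S), A (halfTest a hS) = B (halfTest a hS)) :
    A = B := by
  have hker : (A - B).kerᗮ = ⊥ := by
    rw [eq_bot_iff]
    intro h hh
    refine (Submodule.mem_bot ℂ).2 (eq_zero_of_inner_halfTest fun a S hS => hh _ ?_)
    simp [H]
  have hc : IsClosed ((A - B).ker : Set L2R) := (A - B).isClosed_ker
  rw [← sub_eq_zero]
  have := (Submodule.topologicalClosure_eq_top_iff).2 hker
  rw [hc.submodule_topologicalClosure_eq] at this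
  ext1 f
  have hf : f ∈ (A - B).ker := this ▸ Submodule.mem_top
  exact hf

/-! ### Level sums -/

theorem D_inv_T_zpow (k : ℤ) (f : L2R) : D⁻¹ ((T ^ k) f) = (T ^ (2 * k)) (D⁻¹ f) := by
  rw [T_zpow_eq_shift, T_zpow_eq_shift]
  have h2 : (0 : ℝ) < 2⁻¹ := by norm_num
  change scale 2⁻¹ h2 _ = shift _ (scale 2⁻¹ h2 f)
  apply Lp.ext
  filter_upwards [coeFn_scale h2 (shift k f), ae_comp_mul h2 (coeFn_shift k f),
    coeFn_shift ((2 * k : ℤ) : ℝ) (scale 2⁻¹ h2 f),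
    ae_comp_sub ((2 * k : ℤ) : ℝ) (coeFn_scale h2 f)] with x h1 h2 h3 h4
  rw [h1, h2, h3, h4]
  congr 2
  push_cast
  ring

theorem wav_neg_one (k : ℤ) (f : L2R) : wav (-1) k f = (T ^ (2 * k)) (D⁻¹ f) := by
  rw [wav, zpow_neg_one, D_inv_T_zpow]

theorem wav_zero (k : ℤ) (f : L2R) : wav 0 k f = (T ^ k) f := by
  rw [wav, zpow_zero, LinearIsometryEquiv.coe_one, id]

theorem wav_add (m j k : ℤ) (f : L2R) : wav (m + j) k f = (D ^ m) (wav j k f) := by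
  rw [wav, wav, zpow_add]
  rfl

theorem term_add (φ φt : L2R) (m j : ℤ) (f : L2R) (k : ℤ) :
    term φ φt (m + j) ((D ^ m) f) k = (D ^ m) (term φ φt j f k) := by
  rw [term, term, wav_add, wav_add, LinearIsometryEquiv.inner_map_map, map_smul]

theorem exists_eq_D_zpow (m : ℤ) (f : L2R) : ∃ g, f = (D ^ m) g :=
  ⟨(D ^ m).symm f, ((D ^ m).apply_symm_apply f).symm⟩

theorem LevelConverges.add {n : ℕ} {Φ Φt : Fin n → L2R} {j : ℤ} (h : LevelConverges Φ Φt j)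
    (m : ℤ) : LevelConverges Φ Φt (m + j) := by
  intro i f
  obtain ⟨g, rfl⟩ := exists_eq_D_zpow m f
  refine ((h i g).mapL ((D ^ m : L2R ≃ₗᵢ[ℂ] L2R).toContinuousLinearEquiv :
    L2R →L[ℂ] L2R)).congr fun k => ?_
  rw [term_add]
  rfl

theorem LevelConverges.of_level {n : ℕ} {Φ Φt : Fin n → L2R} {j : ℤ}
    (h : LevelConverges Φ Φt j) (j' : ℤ) : LevelConverges Φ Φt j' := by
  simpa using h.add (j' - j)

theorem levelSum_add {n : ℕ} (Φ Φt : Fin n → L2R) (m j : ℤ) (f : L2R) :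
    levelSum Φ Φt (m + j) ((D ^ m) f) = (D ^ m) (levelSum Φ Φt j f) := by
  rw [levelSum, levelSum, map_sum]
  refine Finset.sum_congr rfl fun i _ => ?_
  simp_rw [term_add]
  exact ((D ^ m : L2R ≃ₗᵢ[ℂ] L2R).toContinuousLinearEquiv.map_tsum).symm

/-- Banach–Steinhaus: the partial sums are bounded finite-rank operators converging pointwise. This
boundedness lets identities pass from test functions to all of $L^2$. -/
theorem LevelConverges.exists_clm {n : ℕ} {Φ Φt : Fin n → L2R} {j : ℤ}
    (h : LevelConverges Φ Φt j) : ∃ L : L2R →L[ℂ] L2R, ∀ f, L f = levelSum Φ Φt j f := by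
  have key : ∀ i, ∃ L : L2R →L[ℂ] L2R, ∀ f, L f = ∑' k, term (Φ i) (Φt i) j f k := by
    intro i
    let g : Finset ℤ → L2R →L[ℂ] L2R := fun s =>
      ∑ k ∈ s, (innerSL ℂ (wav j k (Φt i))).smulRight (wav j k (Φ i))
    have hg : Tendsto (fun s f => g s f) atTop (𝓝 fun f => ∑' k, term (Φ i) (Φt i) j f k) := by
      refine tendsto_pi_nhds.2 fun f => ?_
      refine Tendsto.congr (fun s => ?_) (h i f).hasSum
      simp [g, term]
    exact ⟨continuousLinearMapOfTendsto g hg, fun f => rfl⟩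
  choose L hL using key
  exact ⟨∑ i, L i, fun f => by simp [levelSum, hL]⟩

theorem inner_levelSum {n : ℕ} {Φ Φt : Fin n → L2R} {j : ℤ} (h : LevelConverges Φ Φt j)
    {f g : L2R} {c : Fin n → ℂ}
    (hc : ∀ i, HasSum (fun k => inner ℂ (wav j k (Φt i)) f * inner ℂ g (wav j k (Φ i))) (c i)) :
    inner ℂ g (levelSum Φ Φt j f) = ∑ i, c i := by
  rw [levelSum, inner_sum]
  refine Finset.sum_congr rfl fun i _ => ?_
  refine ((h i f).hasSum.mapL (innerSL ℂ g)).unique ((hc i).congr_fun fun k => ?_)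
  rw [term, innerSL_apply_apply, inner_smul_right]

theorem hasSum_of_even_of_odd {f : ℤ → ℂ} {a b : ℂ} (ha : HasSum (fun k => f (2 * k)) a)
    (hb : HasSum (fun k => f (2 * k + 1)) b) : HasSum f (a + b) := by
  have h2 : Function.Injective fun k : ℤ => 2 * k := mul_right_injective₀ two_ne_zero
  have h3 : Function.Injective fun k : ℤ => 2 * k + 1 := (add_left_injective 1).comp h2
  refine HasSum.add_isCompl (s := Set.range fun k : ℤ => 2 * k)
    (t := Set.range fun k : ℤ => 2 * k + 1) ?_ (h2.hasSum_range_iff.2 ha)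
    (h3.hasSum_range_iff.2 hb)
  simpa only [Set.range, even_iff_exists_two_mul, Odd, eq_comm] using Int.isCompl_even_odd

/-! ### The kernel of a level sum on the Fourier side -/

/-- `∑ᵢ f̂ᵢ(y) conj (ĝᵢ(z))`. -/
noncomputable def fourierKernel {n : ℕ} (Φ Φt : Fin n → L2R) (y z : ℝ) : ℂ :=
  ∑ i, (𝓕 (Φ i) : L2R) y * conj ((𝓕 (Φt i) : L2R) z)

theorem integrable_mul_conj (f g : L2R) (a b : ℝ) :
    Integrable (fun θ => f (θ + b) * conj (g (θ + a))) volume :=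
  (memLp_comp_add f b).integrable_mul (memLp_comp_add g a).star

theorem integrable_fourierKernel {n : ℕ} (Φ Φt : Fin n → L2R) (a b : ℝ) :
    Integrable (fun θ => fourierKernel Φ Φt (θ + b) (θ + a)) volume :=
  integrable_finsetSum _ fun _ _ => integrable_mul_conj _ _ _ _

theorem integral_fourierKernel {n : ℕ} (Φ Φt : Fin n → L2R) (a b : ℝ) (S : Set ℝ) :
    ∫ θ in S, fourierKernel Φ Φt (θ + b) (θ + a) =
      ∑ i, ∫ θ in S, (𝓕 (Φ i) : L2R) (θ + b) * conj ((𝓕 (Φt i) : L2R) (θ + a)) :=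
  integral_finsetSum _ fun _ _ => (integrable_mul_conj _ _ _ _).restrict

theorem inner_levelSum_neg_one {n : ℕ} {Φ Φt : Fin n → L2R} (h : LevelConverges Φ Φt (-1))
    (a b : ℤ) {S S' : Set ℝ} (hS : MeasurableSet S) (hS' : MeasurableSet S') :
    inner ℂ (halfTest b hS') (levelSum Φ Φt (-1) (halfTest a hS)) =
      2⁻¹ * ∫ θ in S ∩ S' ∩ halfIoc,
        fourierKernel (fun i => D⁻¹ (Φ i)) (fun i => D⁻¹ (Φt i)) (θ + b / 2) (θ + a / 2) := by
  rw [integral_fourierKernel, Finset.mul_sum]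
  refine inner_levelSum h fun i => ?_
  simp_rw [wav_neg_one]
  exact hasSum_halfTest a b hS hS' _ _

theorem T_zpow_two_mul_T (k : ℤ) (f : L2R) : (T ^ (2 * k)) (T f) = (T ^ (2 * k + 1)) f := by
  rw [zpow_add_one, LinearIsometryEquiv.coe_mul, Function.comp_apply]

/-- The two phases produced by `T` are evaluated at points differing by $(a-b)/2$, so `θ` cancels
from their product. -/
theorem integral_T_mul_conj_T (a b : ℤ) (f g : L2R) (S : Set ℝ) :
    ∫ θ in S, (𝓕 (T f) : L2R) (θ + b / 2) * conj ((𝓕 (T g) : L2R) (θ + a / 2)) =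
      (expc ((a - b : ℤ) / 2) : ℂ) *
        ∫ θ in S, (𝓕 f : L2R) (θ + b / 2) * conj ((𝓕 g : L2R) (θ + a / 2)) := by
  rw [← integral_const_mul]
  refine integral_congr_ae (ae_restrict_of_ae ?_)
  filter_upwards [ae_comp_add (b / 2 : ℝ) (fourier_T_zpow 1 f),
    ae_comp_add (a / 2 : ℝ) (fourier_T_zpow 1 g)] with θ h1 h2
  rw [zpow_one] at h1 h2
  have h3 : (expc ((a - b : ℤ) / 2) : ℂ) = expc (-((1 : ℤ) * (θ + b / 2))) *
      conj (expc (-((1 : ℤ) * (θ + a / 2))) : ℂ) := by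
    rw [← Circle.coe_inv_eq_conj, ← Circle.coe_mul, expc, expc, expc, ← Circle.exp_neg,
      ← Circle.exp_add]
    congr 2
    push_cast
    ring
  rw [h1, h2, h3, map_mul]
  ring

/-- Odd translates of a function are the even translates of its image under `T`, so the
even-translate formula applies twice. -/
theorem hasSum_halfTest_all (a b : ℤ) {S S' : Set ℝ} (hS : MeasurableSet S)
    (hS' : MeasurableSet S') (η ηt : L2R) :
    HasSum (fun k : ℤ => inner ℂ ((T ^ k) ηt) (halfTest a hS) *
        inner ℂ (halfTest b hS') ((T ^ k) η))
      (2⁻¹ * ((1 + (expc ((a - b : ℤ) / 2) : ℂ)) * ∫ θ in S ∩ S' ∩ halfIoc,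
        (𝓕 η : L2R) (θ + b / 2) * conj ((𝓕 ηt : L2R) (θ + a / 2)))) := by
  have hodd := hasSum_halfTest a b hS hS' (T η) (T ηt)
  simp_rw [T_zpow_two_mul_T] at hodd
  rw [integral_T_mul_conj_T] at hodd
  rw [one_add_mul, mul_add]
  exact hasSum_of_even_of_odd (f := fun k : ℤ => inner ℂ ((T ^ k) ηt) (halfTest a hS) *
    inner ℂ (halfTest b hS') ((T ^ k) η)) (hasSum_halfTest a b hS hS' η ηt) hodd

theorem inner_levelSum_zero {n : ℕ} {Φ Φt : Fin n → L2R} (h : LevelConverges Φ Φt 0)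
    (a b : ℤ) {S S' : Set ℝ} (hS : MeasurableSet S) (hS' : MeasurableSet S') :
    inner ℂ (halfTest b hS') (levelSum Φ Φt 0 (halfTest a hS)) =
      2⁻¹ * ∫ θ in S ∩ S' ∩ halfIoc, (1 + (expc ((a - b : ℤ) / 2) : ℂ)) *
        fourierKernel Φ Φt (θ + b / 2) (θ + a / 2) := by
  rw [integral_const_mul, integral_fourierKernel, Finset.mul_sum, Finset.mul_sum]
  refine inner_levelSum h fun i => ?_
  simp_rw [wav_zero]
  exact hasSum_halfTest_all a b hS hS' _ _

theorem levelSum_zero_eq_iff {r s : ℕ} {Φ Φt : Fin r → L2R} {Ψ Ψt : Fin s → L2R}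
    (hΦ : LevelConverges Φ Φt 0) (hΨ : LevelConverges Ψ Ψt 0) :
    (∀ f, levelSum Φ Φt 0 f = levelSum Φ Φt (-1) f + levelSum Ψ Ψt (-1) f) ↔
      ∀ᵐ y : ℝ, ∀ d : ℤ,
        fourierKernel (fun i => D⁻¹ (Φ i)) (fun i => D⁻¹ (Φt i)) y (y + d / 2) +
          fourierKernel (fun l => D⁻¹ (Ψ l)) (fun l => D⁻¹ (Ψt l)) y (y + d / 2) =
        (1 + (expc (d / 2) : ℂ)) * fourierKernel Φ Φt y (y + d / 2) := by
  have hint := fun {n : ℕ} (Φ Φt : Fin n → L2R) (a b : ℤ) =>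
    integrable_fourierKernel Φ Φt (a / 2) (b / 2)
  have hadd : ∀ (a b : ℤ) {S S' : Set ℝ} (hS : MeasurableSet S) (hS' : MeasurableSet S'),
      inner ℂ (halfTest b hS') (levelSum Φ Φt (-1) (halfTest a hS) +
          levelSum Ψ Ψt (-1) (halfTest a hS)) =
        2⁻¹ * ∫ θ in S ∩ S' ∩ halfIoc,
          (fourierKernel (fun i => D⁻¹ (Φ i)) (fun i => D⁻¹ (Φt i)) (θ + b / 2) (θ + a / 2) +
          fourierKernel (fun l => D⁻¹ (Ψ l)) (fun l => D⁻¹ (Ψt l)) (θ + b / 2) (θ + a / 2)) := by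
    intro a b S S' hS hS'
    rw [inner_add_right, inner_levelSum_neg_one (hΦ.of_level _),
      inner_levelSum_neg_one (hΨ.of_level _), ← mul_add,
      ← integral_add (hint _ _ _ _).restrict (hint _ _ _ _).restrict]
  constructor
  · intro H
    have key : ∀ a b : ℤ, ∀ᵐ θ ∂volume.restrict halfIoc,
        fourierKernel (fun i => D⁻¹ (Φ i)) (fun i => D⁻¹ (Φt i)) (θ + b / 2) (θ + a / 2) +
          fourierKernel (fun l => D⁻¹ (Ψ l)) (fun l => D⁻¹ (Ψt l)) (θ + b / 2) (θ + a / 2) =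
        (1 + (expc ((a - b : ℤ) / 2) : ℂ)) * fourierKernel Φ Φt (θ + b / 2) (θ + a / 2) := by
      intro a b
      refine Integrable.ae_eq_of_forall_setIntegral_eq _ _
        ((hint _ _ _ _).add (hint _ _ _ _)).restrict ((hint _ _ _ _).const_mul _).restrict
        fun S hS _ => ?_
      rw [Measure.restrict_restrict hS]
      -- Letting one set vary already determines the integrand a.e.; the second set is needed only
      -- for the converse.
      have h1 := hadd a b hS MeasurableSet.univ
      rw [← H, inner_levelSum_zero hΦ, Set.inter_univ] at h1
      exact (mul_left_cancel₀ (by norm_num) h1).symm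
    refine ae_of_ae_halfIoc fun b => ?_
    refine ae_all_iff.2 fun d => ?_
    filter_upwards [key (b + d) b] with θ hθ
    rw [add_sub_cancel_left] at hθ
    rw [show θ + (b : ℝ) / 2 + d / 2 = θ + ((b + d : ℤ) : ℝ) / 2 by push_cast; ring]
    exact hθ
  · intro H
    -- Both sides are bounded operators, so agreement of their matrix entries on test functions
    -- suffices.
    obtain ⟨L₀, hL₀⟩ := hΦ.exists_clm
    obtain ⟨L₁, hL₁⟩ := (hΦ.of_level (-1)).exists_clm
    obtain ⟨L₂, hL₂⟩ := (hΨ.of_level (-1)).exists_clm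
    have : L₀ = L₁ + L₂ := by
      refine eq_of_eq_halfTest fun a S hS => ?_
      rw [← sub_eq_zero]
      refine eq_zero_of_inner_halfTest fun b S' hS' => ?_
      rw [inner_sub_right, sub_eq_zero, add_apply, hL₀, hL₁, hL₂, hadd,
        inner_levelSum_zero hΦ]
      congr 1
      refine integral_congr_ae (ae_restrict_of_ae ?_)
      filter_upwards [ae_comp_add (b / 2 : ℝ) H] with θ hθ
      rw [← sub_add_cancel a b, Int.cast_add, add_div, ← add_assoc, add_right_comm, hθ (a - b)]
      simp
    intro f
    rw [← hL₀, ← hL₁, ← hL₂, this]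
    rfl

/-! ### Mask identities -/

theorem expc_half : expc 2⁻¹ = -1 := by
  ext
  rw [expc, Circle.coe_exp, Circle.coe_neg, Circle.coe_one, ← Complex.exp_pi_mul_I]
  congr 1
  push_cast
  ring

theorem expc_add (x y : ℝ) : expc (x + y) = expc x * expc y := by
  rw [expc, mul_add, Circle.exp_add, expc, expc]

theorem expc_add_half (y : ℝ) : expc (y + 2⁻¹) = -expc y := by
  rw [expc_add, expc_half, mul_neg, mul_one]

theorem expc_two_mul (y : ℝ) : expc (2 * y) = expc y ^ 2 := by
  rw [two_mul, expc_add, sq]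

theorem expc_zero : expc 0 = 1 := by
  rw [expc, mul_zero, Circle.exp_zero]

theorem expc_intCast (k : ℤ) : expc k = 1 := by
  rw [← zero_add (k : ℝ), expc_add_intCast, expc_zero]

/-- The function of two points of the circle whose restrictions to `ω' = ω` and `ω' = -ω` are the
left-hand sides of the mask identities. -/
noncomputable def maskForm {r s : ℕ} (φ φt : L2R) (Φ Φt : Fin r → L2R) (Ψ Ψt : Fin s → L2R)
    (ω ω' : Circle) : ℂ :=
  Theta φ φt Φ Φt (ω ^ 2) * mask φ (D⁻¹ φ) ω * conj (mask φt (D⁻¹ φt) ω')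
    + ∑ l, mask φ (D⁻¹ (Ψ l)) ω * conj (mask φt (D⁻¹ (Ψt l)) ω')

theorem D_inv_mem_V0 {φ f : L2R} (h : f ∈ V φ 1) : D⁻¹ f ∈ V0 φ := by
  obtain ⟨g, hg, rfl⟩ := Submodule.mem_map.1 h
  have : D⁻¹ ((D ^ (1 : ℤ)) g) = g := by
    rw [zpow_one]
    exact D.symm_apply_apply g
  change D⁻¹ ((D ^ (1 : ℤ)) g) ∈ V0 φ
  rw [this]
  exact hg

/-- The mask formula for `f` is used at $2y$, that is at $\omega^2$; the remaining
$\sqrt2\,\hat\phi(2y)$ is the transform of $D^{-1}\phi$, which refinability expresses through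
$\hat\phi(y)$. -/
theorem ae_fourier_D_inv_eq_mask_mul {φ f : L2R} (hφ : IsRefinable φ) (hf : f ∈ V0 φ) :
    ∀ᵐ y : ℝ, (𝓕 (D⁻¹ f) : L2R) y =
      conj (mask φ f (expc y ^ 2)) * conj (mask φ (D⁻¹ φ) (expc y)) * (𝓕 φ : L2R) y := by
  filter_upwards [fourier_D_inv f, fourier_D_inv φ, ae_fourier_eq_mask_mul hφ,
    ae_comp_mul two_pos (ae_fourier_eq_mask_mul hf)] with y h1 h2 h3 h4
  rw [h1, h4, mul_left_comm, ← h2, h3, expc_two_mul, mul_assoc]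

theorem fourierKernel_of_mask {n : ℕ} {φ φt : L2R} {Φ Φt : Fin n → L2R}
    {y z : ℝ} {c ct : Fin n → ℂ} (h : ∀ i, (𝓕 (Φ i) : L2R) y = conj (c i) * (𝓕 φ : L2R) y)
    (ht : ∀ i, (𝓕 (Φt i) : L2R) z = conj (ct i) * (𝓕 φt : L2R) z) :
    fourierKernel Φ Φt y z =
      conj (∑ i, c i * conj (ct i)) * ((𝓕 φ : L2R) y * conj ((𝓕 φt : L2R) z)) := by
  rw [fourierKernel, map_sum, Finset.sum_mul]
  refine Finset.sum_congr rfl fun i _ => ?_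
  rw [h, ht]
  simp only [map_mul]
  ring

theorem ae_forall_half {p : ℝ → Prop} (h : ∀ᵐ y, p y) : ∀ᵐ y : ℝ, ∀ d : ℤ, p (y + d / 2) :=
  ae_all_iff.2 fun _ => ae_comp_add _ h

section

variable {r s : ℕ} {φ φt : L2R} {Φ Φt : Fin r → L2R} {Ψ Ψt : Fin s → L2R}

theorem expc_add_half_sq (y : ℝ) (d : ℤ) : expc (y + d / 2) ^ 2 = expc y ^ 2 := by
  rw [← expc_two_mul, ← expc_two_mul, mul_add, mul_div_cancel₀ _ two_ne_zero, expc_add_intCast]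

theorem ae_fourierKernel_eq_mul
    (hφ : IsRefinable φ) (hφt : IsRefinable φt)
    (hΦ : ∀ i, Φ i ∈ V0 φ) (hΨ : ∀ l, Ψ l ∈ V φ 1)
    (hΦt : ∀ i, Φt i ∈ V0 φt) (hΨt : ∀ l, Ψt l ∈ V φt 1) :
    ∀ᵐ y : ℝ, ∀ d : ℤ,
      fourierKernel (fun i => D⁻¹ (Φ i)) (fun i => D⁻¹ (Φt i)) y (y + d / 2) +
        fourierKernel (fun l => D⁻¹ (Ψ l)) (fun l => D⁻¹ (Ψt l)) y (y + d / 2) =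
          conj (maskForm φ φt Φ Φt Ψ Ψt (expc y) (expc (y + d / 2))) *
            ((𝓕 φ : L2R) y * conj ((𝓕 φt : L2R) (y + d / 2))) ∧
      fourierKernel Φ Φt y (y + d / 2) =
        conj (∑ i, mask φ (Φ i) (expc y) * conj (mask φt (Φt i) (expc (y + d / 2)))) *
            ((𝓕 φ : L2R) y * conj ((𝓕 φt : L2R) (y + d / 2))) := by
  have h1 := ae_all_iff.2 fun i => ae_fourier_D_inv_eq_mask_mul hφ (hΦ i)
  have h2 := ae_all_iff.2 fun l => ae_fourier_eq_mask_mul (D_inv_mem_V0 (hΨ l))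
  have h3 := ae_all_iff.2 fun i => ae_fourier_eq_mask_mul (hΦ i)
  have h1t := ae_all_iff.2 fun i => ae_fourier_D_inv_eq_mask_mul hφt (hΦt i)
  have h2t := ae_all_iff.2 fun l => ae_fourier_eq_mask_mul (D_inv_mem_V0 (hΨt l))
  have h3t := ae_all_iff.2 fun i => ae_fourier_eq_mask_mul (hΦt i)
  filter_upwards [h1, h2, h3, ae_forall_half h1t, ae_forall_half h2t, ae_forall_half h3t]
    with y h1 h2 h3 h1t h2t h3t d
  refine ⟨?_, fourierKernel_of_mask h3 (h3t d)⟩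
  have h4 : fourierKernel (fun i => D⁻¹ (Φ i)) (fun i => D⁻¹ (Φt i)) y (y + d / 2) =
      conj (Theta φ φt Φ Φt (expc y ^ 2) * mask φ (D⁻¹ φ) (expc y) *
        conj (mask φt (D⁻¹ φt) (expc (y + d / 2)))) *
        ((𝓕 φ : L2R) y * conj ((𝓕 φt : L2R) (y + d / 2))) := by
    rw [fourierKernel_of_mask (φ := φ) (φt := φt)
      (c := fun i => mask φ (Φ i) (expc y ^ 2) * mask φ (D⁻¹ φ) (expc y))
      (ct := fun i => mask φt (Φt i) (expc y ^ 2) * mask φt (D⁻¹ φt) (expc (y + d / 2)))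
      (fun i => by rw [h1, map_mul])
      -- Points over $\omega$ and $-\omega$ have the same square, so the sum over `i` collapses to
      -- $\Theta(\omega^2)$ for every `d`.
      (fun i => by rw [h1t, map_mul, expc_add_half_sq])]
    congr 2
    rw [Theta, Finset.sum_mul, Finset.sum_mul]
    refine Finset.sum_congr rfl fun i _ => ?_
    rw [map_mul]
    ring
  rw [h4, fourierKernel_of_mask h2 (h2t d), maskForm, map_add, add_mul]

theorem maskIdentities_iff
    (hφ : IsRefinable φ) (hφt : IsRefinable φt)
    (hΦ : ∀ i, Φ i ∈ V0 φ) (hΨ : ∀ l, Ψ l ∈ V φ 1)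
    (hΦt : ∀ i, Φt i ∈ V0 φt) (hΨt : ∀ l, Ψt l ∈ V φt 1) :
    (∀ᵐ y : ℝ, ∀ d : ℤ,
        fourierKernel (fun i => D⁻¹ (Φ i)) (fun i => D⁻¹ (Φt i)) y (y + d / 2) +
          fourierKernel (fun l => D⁻¹ (Ψ l)) (fun l => D⁻¹ (Ψt l)) y (y + d / 2) =
        (1 + (expc (d / 2) : ℂ)) * fourierKernel Φ Φt y (y + d / 2)) ↔
      MaskIdentityOne φ φt Φ Φt Ψ Ψt ∧ MaskIdentityTwo φ φt Φ Φt Ψ Ψt := by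
  have hK := ae_fourierKernel_eq_mul hφ hφt hΦ hΨ hΦt hΨt
  have hσ := ae_expc_mem_spec_iff φ
  have hσt := ae_forall_half (ae_expc_mem_spec_iff φt)
  have hev : ∀ (y : ℝ) (m : ℤ), y + ((2 * m : ℤ) : ℝ) / 2 = y + m := fun y m => by
    push_cast; ring
  have hod : ∀ (y : ℝ) (m : ℤ), y + ((2 * m + 1 : ℤ) : ℝ) / 2 = y + 2⁻¹ + m := fun y m => by
    push_cast; ring
  have hev0 : ∀ m : ℤ, expc (((2 * m : ℤ) : ℝ) / 2) = 1 := fun m => by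
    rw [← zero_add (_ / 2), hev, zero_add, expc_intCast]
  have hod0 : ∀ m : ℤ, expc (((2 * m + 1 : ℤ) : ℝ) / 2) = -1 := fun m => by
    rw [← zero_add (_ / 2), hod, zero_add, expc_add_intCast, expc_half]
  have hev1 : ∀ (y : ℝ) (m : ℤ), expc (y + ((2 * m : ℤ) : ℝ) / 2) = expc y := fun y m => by
    rw [hev, expc_add_intCast]
  have hod1 : ∀ (y : ℝ) (m : ℤ), expc (y + ((2 * m + 1 : ℤ) : ℝ) / 2) = -expc y := fun y m => by
    rw [hod, expc_add_intCast, expc_add_half]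
  constructor
  · intro H
    have H' : ∀ᵐ y : ℝ, ∀ d : ℤ, (𝓕 φ : L2R) y ≠ 0 → (𝓕 φt : L2R) (y + d / 2) ≠ 0 →
        conj (maskForm φ φt Φ Φt Ψ Ψt (expc y) (expc (y + d / 2))) = (1 + (expc (d / 2) : ℂ)) *
          conj (∑ i, mask φ (Φ i) (expc y) * conj (mask φt (Φt i) (expc (y + d / 2)))) := by
      filter_upwards [H, hK] with y hy hKy d hφy hφty
      have := hy d
      rw [(hKy d).1, (hKy d).2, ← mul_assoc (1 + (expc (d / 2) : ℂ))] at this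
      exact mul_right_cancel₀ (mul_ne_zero hφy ((map_ne_zero (starRingEnd ℂ)).2 hφty)) this
    have H'' := ae_all_iff.2 fun n : ℤ => ae_comp_add (n : ℝ) H'
    constructor
    · rw [MaskIdentityOne, ae_circleMeasure_iff]
      filter_upwards [H'', hσ, hσt] with y hy hσ hσt ⟨hω, hωt⟩
      obtain ⟨k, hk⟩ := hσ.1 hω
      have h0 := hσt 0
      rw [Int.cast_zero, zero_div, add_zero] at h0
      obtain ⟨k', hk'⟩ := h0.1 hωt
      -- Masks depend only on the circle point, so `y` may be replaced by a representative `y + k`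
      -- with $\hat\phi\ne0$; this `d` moves it to `y + k'`, where the dual transform is nonzero.
      have := hy k (2 * (k' - k)) hk (by
        rw [hev]; push_cast; rwa [add_add_sub_cancel])
      rw [hev1, expc_add_intCast, hev0, Circle.coe_one] at this
      have := congrArg conj this
      rw [map_mul, Complex.conj_conj, Complex.conj_conj, map_add, map_one, one_add_one_eq_two]
        at this
      exact this
    · rw [MaskIdentityTwo, ae_circleMeasure_iff]
      filter_upwards [H'', hσ, hσt] with y hy hσ hσt hω hωt
      obtain ⟨k, hk⟩ := hσ.1 hω
      have h0 := hσt 1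
      rw [Int.cast_one, one_div, expc_add_half] at h0
      obtain ⟨k', hk'⟩ := h0.1 hωt
      -- The same choice, with the extra half step that leads from $\omega$ to $-\omega$.
      have := hy k (2 * (k' - k) + 1) hk (by
        rw [hod]; push_cast
        rwa [show y + k + 2⁻¹ + ((k' : ℝ) - k) = y + 2⁻¹ + k' by ring])
      rw [hod1, expc_add_intCast, hod0, Circle.coe_neg, Circle.coe_one, add_neg_cancel,
        zero_mul, map_eq_zero] at this
      exact this
  · rintro ⟨h1, h2⟩
    rw [MaskIdentityOne, ae_circleMeasure_iff] at h1
    rw [MaskIdentityTwo, ae_circleMeasure_iff] at h2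
    filter_upwards [h1, h2, hK, hσ, hσt] with y h1 h2 hK hσ hσt d
    rw [(hK d).1, (hK d).2, ← mul_assoc (1 + (expc (d / 2) : ℂ))]
    by_cases hφy : (𝓕 φ : L2R) y = 0
    · simp [hφy]
    by_cases hφty : (𝓕 φt : L2R) (y + d / 2) = 0
    · simp [hφty]
    congr 1
    have hω : expc y ∈ spec φ := hσ.2 ⟨0, by simpa using hφy⟩
    have hωt : expc (y + d / 2) ∈ spec φt := (hσt d).2 ⟨0, by simpa using hφty⟩
    obtain ⟨m, rfl | rfl⟩ := Int.even_or_odd' d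
    · rw [hev1] at hωt ⊢
      rw [hev0, Circle.coe_one, one_add_one_eq_two]
      refine (congrArg conj (h1 ⟨hω, hωt⟩)).trans ?_
      rw [map_mul, map_ofNat]
      rfl
    · rw [hod1] at hωt ⊢
      rw [hod0, Circle.coe_neg, Circle.coe_one, add_neg_cancel, zero_mul, map_eq_zero]
      exact h2 hω hωt

/-! ### The recursion between levels -/

theorem levelSum_succ (h : ∀ f, levelSum Φ Φt 0 f = levelSum Φ Φt (-1) f + levelSum Ψ Ψt (-1) f)
    (j : ℤ) (f : L2R) : levelSum Φ Φt (j + 1) f = levelSum Φ Φt j f + levelSum Ψ Ψt j f := by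
  obtain ⟨g, rfl⟩ := exists_eq_D_zpow (j + 1) f
  have h1 := levelSum_add Φ Φt (j + 1) 0 g
  have h2 := levelSum_add Φ Φt (j + 1) (-1) g
  have h3 := levelSum_add Ψ Ψt (j + 1) (-1) g
  rw [add_zero] at h1
  rw [add_neg_cancel_right] at h2 h3
  rw [h1, h2, h3, h, map_add]

theorem levelSum_eq_add_sum
    (h : ∀ f, levelSum Φ Φt 0 f = levelSum Φ Φt (-1) f + levelSum Ψ Ψt (-1) f)
    (J : ℤ) (f : L2R) {N : ℤ} (hN : J ≤ N) :
    levelSum Φ Φt J f + ∑ j ∈ Finset.Ico J N, levelSum Ψ Ψt j f = levelSum Φ Φt N f := by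
  induction N, hN using Int.leInduction with
  | base => simp
  | succ N hN ih =>
    rw [levelSum_succ h, ← ih, ← Finset.insert_Ico_right_eq_Ico_add_one hN,
      Finset.sum_insert Finset.right_notMem_Ico]
    abel

theorem IsDualPair.add {J : ℤ} (h : IsDualPair Φ Φt Ψ Ψt J) (m : ℤ) :
    IsDualPair Φ Φt Ψ Ψt (m + J) := by
  refine ⟨h.1.add m, fun j _ => (h.2.1 J le_rfl).of_level j, fun f => ?_⟩
  obtain ⟨g, rfl⟩ := exists_eq_D_zpow m f
  -- The upper limit becomes `N - m`, so that after the shift by `m` the scales run from `m + J` to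
  -- `N`.
  have h1 := (((D ^ m).continuous.tendsto g).comp (h.2.2 g)).comp
    (tendsto_atTop_add_const_right atTop (-m) tendsto_id)
  refine h1.congr fun N => ?_
  simp only [Function.comp_apply, id, map_add, map_sum, ← levelSum_add]
  congr 1
  simp_rw [add_comm m _]
  rw [Finset.sum_Ico_add' (fun j => levelSum Ψ Ψt j ((D ^ m) g)), neg_add_cancel_right]

/-- Two expansions of the same `f` are subtracted: all scales above `J` cancel, so the difference of
partial sums is eventually constant, with limit zero. -/
theorem IsDualPair.levelSum_succ {J : ℤ} (h : IsDualPair Φ Φt Ψ Ψt J)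
    (h' : IsDualPair Φ Φt Ψ Ψt (J + 1)) (f : L2R) :
    levelSum Φ Φt (J + 1) f = levelSum Φ Φt J f + levelSum Ψ Ψt J f := by
  have h1 := (h.2.2 f).sub (h'.2.2 f)
  rw [sub_self] at h1
  have h2 : Tendsto (fun _ : ℤ => levelSum Φ Φt J f + levelSum Ψ Ψt J f -
      levelSum Φ Φt (J + 1) f) atTop (𝓝 0) := by
    refine h1.congr' ?_
    filter_upwards [eventually_ge_atTop (J + 1)] with N hN
    rw [← Finset.insert_Ico_add_one_left_eq_Ico (show J < N by lia),
      Finset.sum_insert (by simp)]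
    abel
  exact (sub_eq_zero.1 (tendsto_nhds_unique tendsto_const_nhds h2)).symm

theorem IsDualPair.of_level {J : ℤ} (h : IsDualPair Φ Φt Ψ Ψt J) (J' : ℤ) :
    IsDualPair Φ Φt Ψ Ψt J' := by
  simpa using h.add (J' - J)

theorem forall_isDualPair_iff :
    (∀ J, IsDualPair Φ Φt Ψ Ψt J) ↔ LevelConverges Ψ Ψt 0 ∧ Completeness Φ Φt ∧
      ∀ f, levelSum Φ Φt 0 f = levelSum Φ Φt (-1) f + levelSum Ψ Ψt (-1) f := by
  constructor
  · intro h
    have hs : ∀ f, levelSum Φ Φt 0 f = levelSum Φ Φt (-1) f + levelSum Ψ Ψt (-1) f := fun f => by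
      have := (h (-1)).levelSum_succ (h _) f
      rwa [neg_add_cancel] at this
    refine ⟨(h 0).2.1 0 le_rfl, ⟨fun J => (h J).1, fun f => ?_⟩, hs⟩
    refine ((h 0).2.2 f).congr' ?_
    filter_upwards [eventually_ge_atTop 0] with N hN
    exact levelSum_eq_add_sum hs 0 f hN
  · rintro ⟨hΨ, ⟨hΦ, hlim⟩, hs⟩ J
    refine ⟨hΦ J, fun j _ => hΨ.of_level j, fun f => (hlim f).congr' ?_⟩
    filter_upwards [eventually_ge_atTop J] with N hN
    exact (levelSum_eq_add_sum hs J f hN).symm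

end

end OEP

theorem mainTheorem5 {r s : ℕ} (φ φt : OEP.L2R)
    (Φ Φt : Fin r → OEP.L2R) (Ψ Ψt : Fin s → OEP.L2R)
    (hφ : OEP.IsRefinable φ) (hφt : OEP.IsRefinable φt)
    (hΦ : ∀ i, Φ i ∈ OEP.V0 φ) (hΨ : ∀ l, Ψ l ∈ OEP.V φ 1)
    (hΦt : ∀ i, Φt i ∈ OEP.V0 φt) (hΨt : ∀ l, Ψt l ∈ OEP.V φt 1)
    (hboundΦ : ∀ i, MemLp (fun ω : Circle => ‖OEP.per (Φ i) ω‖ * ‖OEP.per (Φt i) ω‖) ⊤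
      OEP.circleMeasure)
    (hboundΨ : ∀ l, MemLp (fun ω : Circle => ‖OEP.per (Ψ l) ω‖ * ‖OEP.per (Ψt l) ω‖) ⊤
      OEP.circleMeasure) :
    List.TFAE
      [∃ J : ℤ, OEP.IsDualPair Φ Φt Ψ Ψt J,
       ∀ J : ℤ, OEP.IsDualPair Φ Φt Ψ Ψt J,
       OEP.LevelConverges Ψ Ψt 0 ∧ OEP.Completeness Φ Φt ∧
         OEP.MaskIdentityOne φ φt Φ Φt Ψ Ψt ∧ OEP.MaskIdentityTwo φ φt Φ Φt Ψ Ψt] := by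
  tfae_have 1 → 2 := fun ⟨_, h⟩ J => h.of_level J
  tfae_have 2 → 1 := fun h => ⟨0, h 0⟩
  tfae_have 2 ↔ 3 := by
    rw [OEP.forall_isDualPair_iff, ← OEP.maskIdentities_iff hφ hφt hΦ hΨ hΦt hΨt]
    refine and_congr_right fun h1 => and_congr_right fun h2 => ?_
    exact OEP.levelSum_zero_eq_iff (h2.1 0) h1
  tfae_finish
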